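/- Let $p_1<p_2<\dots$ be the primes. For a real sequence $\mathbf x=(x_1,x_2,\dots)\in\mathbb R^\infty$ and $\operatorname{Re}s>1$ put $$\zeta_{\mathbf x}(s)=\sum_{n\ge 1}e^{i\langle \mathbf r_n,\mathbf x\rangle}n^{-s},\qquad \langle \mathbf r_n,\mathbf x\rangle=\sum_{k\ge1} r_{n,k}x_k,\quad\text{where } n=\prod_{k\ge1}p_k^{r_{n,k}}$$ (these are the Dirichlet series equivalent, in the sense of Bohr, to the Riemann zeta function). A set $S\subset\mathbb R$ is relatively dense if there is $l>0$ such that every interval $[a,a+l]$, $a\in\mathbb R$, contains a point of $S$. A continuous curve $\gamma:(a,b)\to\mathbb C\setminus\{0\}$ makes at least $n$ turns around the origin if, for a continuous branch $\theta$ of its argument on $(a,b)$, there are $u,v\in(a,b)$ with $|\theta(v)-\theta(u)|\ge 2\pi n$. Theorem. Let $\mathbf x\in\mathbb R^\infty$, $\sigma_0>1$ and $n\in\mathbb N$. Then there exists a relatively dense set of real numbers $\{t_{n,m}\}_{m\ge1}$ such that, for each $m=1,2,\dots$, the parametrized curve $\sigma\mapsto\zeta_{\mathbf x}(\sigma+it_{n,m})$,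 $\sigma\in(1,\sigma_0)$, is a continuous curve that avoids the origin and makes at least $n$ turns around the origin. -/

import Mathlib

/-- The pairing `⟨r_n, x⟩ = ∑_k r_{n,k} x_k`, where `n = ∏_k p_k ^ r_{n,k}` is the prime
factorization of `n`.  Sequences are indexed from `0`, so that `x k` belongs to the prime
`Nat.nth Nat.Prime k`; accordingly the coordinate that belongs to a prime `p` is `x (π' p)`, where
`π' p = Nat.primeCounting' p` is the number of primes smaller than `p`. -/
noncomputable def twistPhase (x : ℕ → ℝ) (n : ℕ) : ℝ :=
  n.factorization.sum fun p r => (r : ℝ) * x (Nat.primeCounting' p)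

/-- The Dirichlet series `ζ_x(s) = ∑_{n ≥ 1} exp(i ⟨r_n, x⟩) n ^ (-s)` (the term of an `LSeries`
at index `0` is `0`).  It is absolutely convergent for `Re s > 1`. -/
noncomputable def zetaTwist (x : ℕ → ℝ) (s : ℂ) : ℂ :=
  LSeries (fun n => Complex.exp (twistPhase x n * Complex.I)) s

/-- A set of reals is relatively dense if, for some `l > 0`, every interval of length `l`
contains a point of it. -/
def IsRelativelyDense (S : Set ℝ) : Prop :=
  ∃ l : ℝ, 0 < l ∧ ∀ a : ℝ, ∃ t ∈ S, t ∈ Set.Icc a (a + l)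

/-- The parametrized curve `γ(σ)`, `σ ∈ (a, b)`, makes at least `n` turns around the origin: it is
continuous, avoids the origin, and a continuous branch `θ` of its argument on `(a, b)` has a net
variation of at least `2πn` (in absolute value) between two points of `(a, b)`.
Two continuous branches differ by a constant, so the choice of `θ` does not matter. -/
def MakesAtLeastTurns (γ : ℝ → ℂ) (a b : ℝ) (n : ℕ) : Prop :=
  ContinuousOn γ (Set.Ioo a b) ∧ (∀ σ ∈ Set.Ioo a b, γ σ ≠ 0) ∧
    ∃ θ : ℝ → ℝ, ContinuousOn θ (Set.Ioo a b) ∧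
      (∀ σ ∈ Set.Ioo a b, γ σ = (‖γ σ‖ : ℂ) * Complex.exp (θ σ * Complex.I)) ∧
      ∃ u ∈ Set.Ioo a b, ∃ v ∈ Set.Ioo a b, 2 * Real.pi * n ≤ |θ v - θ u|

/-!
The Euler product gives `ζ_x(s) = exp (L(s))` with
`L(s) = -∑_p log(1 - exp(i x_p) p ^ (-s))` (`exp_logZetaTwist`), so on each horizontal half-line
the curve avoids the origin and `σ ↦ Im L(σ + it)` is a continuous branch of its argument
(`continuousOn_logZetaTwist`). It is therefore enough to find `1 < u < v < σ₀` such that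
`Im L(u + it) - Im L(v + it) ≥ 2πn` for a relatively dense set of `t`.

Fix `v`. Then `|Im L(v + it)|` is bounded uniformly in `t`, and up to an error bounded uniformly in
`u > 1` and `t`, `L(u + it)` is the prime sum `∑_p exp(i (x_p - t log p)) p ^ (-u)`
(`norm_logZetaTwist_sub_tsum_le`). Since `∑_p 1 / p` diverges, `u` can be chosen so close to `1`
that `∑_p p ^ (-u)` is as large as needed, and then a finite set `S` of primes carries this sum
up to `1`. If `sin (x_p - t log p) ≥ 1 / 2` for all `p ∈ S`, the imaginary part of the prime sum is
at least half of `∑_p p ^ (-u)` up to a constant (`le_im_logZetaTwist`).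

Such `t` are relatively dense by Kronecker's theorem (`isRelativelyDense_setOf_le_cos`), as the
logarithms of the primes are independent by unique factorization. Kronecker's theorem is proved
for `N` frequencies
with the kernel `K(t) = ∏_k ((1 + cos (ω_k t + φ_k)) / 2) ^ r`: its mean over an interval of length
`l` is, uniformly in the position of the interval, at least `(C(2r, r) / 4 ^ r) ^ N - O(1 / l)`,
which decays only polynomially in `r`, whereas `K ≤ ((1 + δ) / 2) ^ r` wherever one of the cosines
is below a given `δ < 1`.
-/

/-! ### Relatively dense simultaneous approximation -/

open Finset in
theorem one_add_cos_div_two_pow_eq_sum (θ : ℝ) (r : ℕ) :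
    ((((1 + Real.cos θ) / 2) ^ r : ℝ) : ℂ) =
      ∑ j ∈ range (2 * r + 1),
        (((2 * r).choose j / 4 ^ r : ℝ) : ℂ) *
          Complex.exp (((((j : ℝ) - r) * θ : ℝ) : ℂ) * Complex.I) := by
  set z := Complex.exp (θ * Complex.I) with hz
  have hz0 : z ≠ 0 := Complex.exp_ne_zero _
  have h1 : (((1 + Real.cos θ) / 2 : ℝ) : ℂ) = z⁻¹ * ((z + 1) ^ 2 / 4) := by
    push_cast
    rw [Complex.cos, neg_mul, Complex.exp_neg, ← hz]
    field_simp
    ring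
  have h2 : ∀ j : ℕ, Complex.exp (((((j : ℝ) - r) * θ : ℝ) : ℂ) * Complex.I) =
      z⁻¹ ^ r * z ^ j := by
    intro j
    rw [hz, ← Complex.exp_neg, ← Complex.exp_nat_mul, ← Complex.exp_nat_mul, ← Complex.exp_add]
    congr 1
    push_cast
    ring
  rw [Complex.ofReal_pow, h1, mul_pow, div_pow, ← pow_mul, add_pow, Finset.sum_div, Finset.mul_sum]
  refine Finset.sum_congr rfl fun j _ => ?_
  rw [h2]
  push_cast
  simp only [one_pow]
  ring

theorem norm_integral_exp_mul_I_le {μ : ℝ} (hμ : μ ≠ 0) (c a b : ℝ) :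
    ‖∫ t in a..b, Complex.exp (((μ * t + c : ℝ) : ℂ) * Complex.I)‖ ≤ 2 / |μ| := by
  have hμI : (μ : ℂ) * Complex.I ≠ 0 :=
    mul_ne_zero (Complex.ofReal_ne_zero.2 hμ) Complex.I_ne_zero
  have h : ∀ t : ℝ, Complex.exp (((μ * t + c : ℝ) : ℂ) * Complex.I) =
      Complex.exp (c * Complex.I) * Complex.exp (μ * Complex.I * t) := by
    intro t
    rw [← Complex.exp_add]
    congr 1
    push_cast
    ring
  have hn : ∀ t : ℝ, ‖Complex.exp (μ * Complex.I * t)‖ = 1 := by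
    intro t
    rw [show (μ : ℂ) * Complex.I * t = ((μ * t : ℝ) : ℂ) * Complex.I by push_cast; ring,
      Complex.norm_exp_ofReal_mul_I]
  simp_rw [h]
  rw [intervalIntegral.integral_const_mul, integral_exp_mul_complex hμI, norm_mul,
    Complex.norm_exp_ofReal_mul_I, one_mul, norm_div, norm_mul, Complex.norm_I, mul_one,
    Complex.norm_real, Real.norm_eq_abs]
  gcongr
  calc _ ≤ ‖Complex.exp (μ * Complex.I * b)‖ + ‖Complex.exp (μ * Complex.I * a)‖ :=
        norm_sub_le _ _
    _ = 2 := by rw [hn, hn]; norm_num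

/-- A trigonometric polynomial whose frequencies other than `i₀` are nonzero, while the one at
`i₀` vanishes with phase `0`, has integral over `[a, a + l]` at distance from `l` times the
coefficient at `i₀` bounded independently of `a` and `l`. -/
theorem exists_norm_integral_sum_exp_sub_le {κ : Type*} [DecidableEq κ] (s : Finset κ) {i₀ : κ}
    (hi₀ : i₀ ∈ s) (c : κ → ℝ) (μ φ : κ → ℝ) (h0 : μ i₀ = 0) (hφ : φ i₀ = 0)
    (hμ : ∀ i ∈ s, i ≠ i₀ → μ i ≠ 0) :
    ∃ C : ℝ, ∀ a l : ℝ,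
      ‖(∫ t in a..(a + l), ∑ i ∈ s,
        (c i : ℂ) * Complex.exp (((μ i * t + φ i : ℝ) : ℂ) * Complex.I)) - c i₀ * l‖ ≤ C := by
  refine ⟨∑ i ∈ s.erase i₀, |c i| * (2 / |μ i|), fun a l => ?_⟩
  rw [intervalIntegral.integral_finsetSum
    (fun i _ => Continuous.intervalIntegrable (by fun_prop) _ _), ← Finset.add_sum_erase _ _ hi₀]
  have h1 : ∫ t in a..(a + l),
      (c i₀ : ℂ) * Complex.exp (((μ i₀ * t + φ i₀ : ℝ) : ℂ) * Complex.I) = c i₀ * l := by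
    simp [h0, hφ, mul_comm]
  rw [h1, add_sub_cancel_left]
  refine norm_sum_le_of_le _ fun i hi => ?_
  rw [intervalIntegral.integral_const_mul, norm_mul, Complex.norm_real, Real.norm_eq_abs]
  gcongr
  exact norm_integral_exp_mul_I_le (hμ i (Finset.mem_of_mem_erase hi)
    (Finset.ne_of_mem_erase hi)) _ _ _

/-- The powers of `C(2r, r) / 4 ^ r`, which is at least `1 / (2r)`, decay more slowly in `r` than
any geometric sequence. -/
theorem exists_pow_lt_centralBinom_div_pow {ρ : ℝ} (h0 : 0 ≤ ρ) (h1 : ρ < 1) (N : ℕ) :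
    ∃ r : ℕ, ρ ^ r < ((r.centralBinom : ℝ) / 4 ^ r) ^ N := by
  have h := tendsto_pow_const_mul_const_pow_of_abs_lt_one N (abs_lt.2 ⟨by linarith, h1⟩)
  have h2 : (0 : ℝ) < (1 / 2) ^ N := by positivity
  obtain ⟨r, hr, hr1⟩ := ((h.eventually (gt_mem_nhds h2)).and
    (Filter.eventually_ge_atTop 1)).exists
  refine ⟨r, ?_⟩
  have hr0 : (0 : ℝ) < r := by exact_mod_cast hr1
  have h3 : (4 : ℝ) ^ r ≤ 2 * r * r.centralBinom := by
    exact_mod_cast Nat.four_pow_le_two_mul_self_mul_centralBinom r hr1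
  calc ρ ^ r = (r ^ N * ρ ^ r) / r ^ N := by field_simp
    _ < (1 / 2) ^ N / r ^ N := by gcongr
    _ = (1 / (2 * r)) ^ N := by rw [← div_pow, div_div]
    _ ≤ _ := by
      refine pow_le_pow_left₀ (by positivity) ?_ N
      rw [div_le_div_iff₀ (by positivity) (by positivity)]
      linarith

/-- **Kronecker's theorem** with relative density: if distinct tuples of natural numbers give
distinct combinations of the frequencies `ω k` (which is linear independence over `ℚ`), then all
the phases `ω k * t + φ k` are simultaneously close to `0` modulo `2π` for a relatively dense set
of `t`. -/
theorem isRelativelyDense_setOf_le_cos {ι : Type*} [Fintype ι] (ω : ι → ℝ)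
    (hω : Function.Injective fun e : ι → ℕ => ∑ k, (e k : ℝ) * ω k) (φ : ι → ℝ) {δ : ℝ}
    (hδ : δ < 1) : IsRelativelyDense {t | ∀ k, δ ≤ Real.cos (ω k * t + φ k)} := by
  classical
  set ρ : ℝ := max 0 ((1 + δ) / 2) with hρ
  have hρ0 : 0 ≤ ρ := le_max_left _ _
  have hρ1 : ρ < 1 := max_lt one_pos (by linarith)
  obtain ⟨r, hr⟩ := exists_pow_lt_centralBinom_div_pow hρ0 hρ1 (Fintype.card ι)
  set A : ℝ := ((r.centralBinom : ℝ) / 4 ^ r) ^ Fintype.card ι with hA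
  set K : ℝ → ℝ := fun t => ∏ k, ((1 + Real.cos (ω k * t + φ k)) / 2) ^ r with hK
  set s : Finset (ι → ℕ) := Fintype.piFinset fun _ => Finset.range (2 * r + 1) with hs
  set c : (ι → ℕ) → ℝ := fun e => ∏ k, ((2 * r).choose (e k) / 4 ^ r : ℝ) with hc
  set μ : (ι → ℕ) → ℝ := fun e => ∑ k, ((e k : ℝ) - r) * ω k with hμ
  set ψ : (ι → ℕ) → ℝ := fun e => ∑ k, ((e k : ℝ) - r) * φ k with hψ
  -- The Fourier expansion of `K`; its constant term is the one at the constant tuple `r`.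
  have hKsum : ∀ t : ℝ, ((K t : ℝ) : ℂ) =
      ∑ e ∈ s, (c e : ℂ) * Complex.exp (((μ e * t + ψ e : ℝ) : ℂ) * Complex.I) := by
    intro t
    simp only [hK]
    rw [Complex.ofReal_prod]
    simp_rw [one_add_cos_div_two_pow_eq_sum]
    rw [Finset.prod_univ_sum]
    refine Finset.sum_congr rfl fun e _ => ?_
    rw [Finset.prod_mul_distrib, ← Complex.exp_sum, hc, Complex.ofReal_prod]
    congr 2
    rw [← Finset.sum_mul, ← Complex.ofReal_sum]
    congr 2
    simp only [hμ, hψ, Finset.sum_mul, ← Finset.sum_add_distrib]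
    exact Finset.sum_congr rfl fun k _ => by ring
  have he₀ : (fun _ => r) ∈ s := by
    rw [hs, Fintype.mem_piFinset]
    intro k
    rw [Finset.mem_range]
    lia
  obtain ⟨C, hC⟩ := exists_norm_integral_sum_exp_sub_le s he₀ c μ ψ (by simp [hμ])
    (by simp [hψ]) (by
      intro e _ hne h
      apply hne
      apply hω
      simpa [hμ, sub_mul, Finset.sum_sub_distrib, sub_eq_zero] using h)
  have hcA : c (fun _ => r) = A := by
    simp [hc, hA, Nat.centralBinom, div_pow]
  have hKc : Continuous K := by fun_prop
  have hgap : 0 < A - ρ ^ r := by linarith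
  refine ⟨(|C| + 1) / (A - ρ ^ r), by positivity, fun a => ?_⟩
  set l : ℝ := (|C| + 1) / (A - ρ ^ r) with hl
  have hl0 : 0 < l := by positivity
  -- Without a good `t` in the interval, `K ≤ ρ ^ r` there, which contradicts the mean value of `K`.
  by_contra! hbad
  have hKle : ∀ t ∈ Set.Icc a (a + l), K t ≤ ρ ^ r := by
    intro t ht
    have : ∃ k, Real.cos (ω k * t + φ k) < δ := by
      by_contra! h
      exact hbad t h ht
    obtain ⟨k, hk⟩ := this
    have h01 : ∀ k, 0 ≤ (1 + Real.cos (ω k * t + φ k)) / 2 ∧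
        (1 + Real.cos (ω k * t + φ k)) / 2 ≤ 1 := fun k =>
      ⟨by linarith [Real.neg_one_le_cos (ω k * t + φ k)],
        by linarith [Real.cos_le_one (ω k * t + φ k)]⟩
    simp only [hK]
    rw [← Finset.mul_prod_erase _ _ (Finset.mem_univ k)]
    calc _ ≤ ρ ^ r * 1 := by
          gcongr
          · exact Finset.prod_nonneg fun j _ => pow_nonneg (h01 j).1 _
          · exact (h01 k).1
          · exact le_trans (by linarith) (le_max_right _ _)
          · exact Finset.prod_le_one (fun j _ => pow_nonneg (h01 j).1 _)
              fun j _ => pow_le_one₀ (h01 j).1 (h01 j).2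
      _ = ρ ^ r := mul_one _
  have hint : ∫ t in a..(a + l), K t ≤ ρ ^ r * l := by
    calc _ ≤ ∫ _t in a..(a + l), ρ ^ r :=
          intervalIntegral.integral_mono_on (by linarith) (hKc.intervalIntegrable _ _)
            (continuous_const.intervalIntegrable _ _) hKle
      _ = ρ ^ r * l := by
          rw [intervalIntegral.integral_const, smul_eq_mul]
          ring
  have hC' := hC a l
  simp_rw [← hKsum] at hC'
  rw [intervalIntegral.integral_ofReal, hcA, ← Complex.ofReal_mul, ← Complex.ofReal_sub,
    Complex.norm_real, Real.norm_eq_abs] at hC'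
  have h1 := (abs_le.1 hC').1
  have h2 : l * (A - ρ ^ r) = |C| + 1 := by
    rw [hl]
    field_simp
  nlinarith [le_abs_self C]

/-- By unique factorization, distinct products of powers of primes have distinct logarithms. -/
theorem injective_sum_natCast_mul_neg_log {ι : Type*} [Fintype ι] {p : ι → ℕ}
    (hp : ∀ i, (p i).Prime) (hinj : Function.Injective p) :
    Function.Injective fun e : ι → ℕ => ∑ i, (e i : ℝ) * -Real.log (p i) := by
  have hlog : ∀ e : ι → ℕ, ∑ i, (e i : ℝ) * -Real.log (p i) =
      -Real.log ((∏ i, p i ^ e i : ℕ) : ℝ) := by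
    intro e
    push_cast
    rw [Real.log_prod fun i _ => pow_ne_zero _ (Nat.cast_ne_zero.2 (hp i).ne_zero),
      ← Finset.sum_neg_distrib]
    refine Finset.sum_congr rfl fun i _ => ?_
    rw [Real.log_pow]
    ring
  have hpos : ∀ e : ι → ℕ, 0 < ∏ i, p i ^ e i := fun e =>
    Finset.prod_pos fun i _ => pow_pos (hp i).pos _
  have hfac : ∀ (e : ι → ℕ) (j : ι), (∏ i, p i ^ e i).factorization (p j) = e j := by
    intro e j
    rw [Nat.factorization_prod_apply fun i _ => pow_ne_zero _ (hp i).ne_zero,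
      Finset.sum_eq_single j]
    · simp [(hp j).factorization_self]
    · intro i _ hij
      rw [(hp i).factorization_pow, Finsupp.single_apply, if_neg]
      exact fun h => hij (hinj h)
    · simp
  intro e e' h
  simp only [hlog, neg_inj] at h
  have h' := Real.log_injOn_pos (Set.mem_Ioi.2 (Nat.cast_pos.2 (hpos e)))
    (Set.mem_Ioi.2 (Nat.cast_pos.2 (hpos e'))) h
  funext j
  rw [← hfac e j, Nat.cast_injective h', hfac]

/-! ### The Euler product of `ζ_x` and its logarithm -/

theorem twistPhase_one (x : ℕ → ℝ) : twistPhase x 1 = 0 := by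
  simp [twistPhase]

theorem twistPhase_mul (x : ℕ → ℝ) {m n : ℕ} (hm : m ≠ 0) (hn : n ≠ 0) :
    twistPhase x (m * n) = twistPhase x m + twistPhase x n := by
  unfold twistPhase
  rw [Nat.factorization_mul hm hn]
  exact Finsupp.sum_add_index' (fun p => by simp) fun p a b => by push_cast; ring

/-- The summands `n ↦ exp(i ⟨r_n, x⟩) n ^ (-s)` of `ζ_x(s)`, which are completely multiplicative
in `n`. -/
noncomputable def zetaTwistSummandHom (x : ℕ → ℝ) (s : ℂ) : ℕ →*₀ ℂ where
  toFun := LSeries.term (fun n => Complex.exp (twistPhase x n * Complex.I)) s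
  map_zero' := LSeries.term_zero _ _
  map_one' := by
    rw [LSeries.term_of_ne_zero one_ne_zero]
    simp [twistPhase_one]
  map_mul' m n := by
    rcases eq_or_ne m 0 with rfl | hm
    · simp
    rcases eq_or_ne n 0 with rfl | hn
    · simp
    rw [LSeries.term_of_ne_zero hm, LSeries.term_of_ne_zero hn,
      LSeries.term_of_ne_zero (mul_ne_zero hm hn), twistPhase_mul x hm hn, Nat.cast_mul,
      Complex.natCast_mul_natCast_cpow, Complex.ofReal_add, add_mul, Complex.exp_add]
    field_simp

theorem zetaTwistSummandHom_apply (x : ℕ → ℝ) (s : ℂ) (n : ℕ) :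
    zetaTwistSummandHom x s n =
      LSeries.term (fun n => Complex.exp (twistPhase x n * Complex.I)) s n :=
  rfl

theorem summable_norm_zetaTwistSummandHom (x : ℕ → ℝ) {s : ℂ} (hs : 1 < s.re) :
    Summable (‖zetaTwistSummandHom x s ·‖) := by
  refine Summable.norm (LSeriesSummable_of_bounded_of_one_lt_re (m := 1) (fun n _ => ?_) hs)
  rw [Complex.norm_exp_ofReal_mul_I]

theorem zetaTwistSummandHom_prime (x : ℕ → ℝ) (σ t : ℝ) (p : Nat.Primes) :
    zetaTwistSummandHom x (σ + t * Complex.I) p = (((p : ℝ) ^ (-σ) : ℝ) : ℂ) *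
      Complex.exp (((-Real.log p * t + twistPhase x p : ℝ) : ℂ) * Complex.I) := by
  have hp : ((p : ℕ) : ℂ) ≠ 0 := Nat.cast_ne_zero.2 p.2.ne_zero
  rw [zetaTwistSummandHom_apply, LSeries.term_of_ne_zero p.2.ne_zero, div_eq_mul_inv, ← Complex.cpow_neg, neg_add,
    Complex.cpow_add _ _ hp, Complex.ofReal_cpow (Nat.cast_nonneg _), Complex.ofReal_natCast,
    Complex.ofReal_neg, mul_left_comm, Complex.cpow_def_of_ne_zero hp (-(t * Complex.I)),
    ← Complex.exp_add, ← Complex.natCast_log]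
  congr 2
  push_cast
  ring

theorem norm_zetaTwistSummandHom_prime (x : ℕ → ℝ) (σ t : ℝ) (p : Nat.Primes) :
    ‖zetaTwistSummandHom x (σ + t * Complex.I) p‖ = (p : ℝ) ^ (-σ) := by
  rw [zetaTwistSummandHom_prime, norm_mul, Complex.norm_exp_ofReal_mul_I, mul_one,
    Complex.norm_real, Real.norm_of_nonneg (by positivity)]

theorem Nat.Primes.rpow_neg_le_half (p : Nat.Primes) {σ : ℝ} (hσ : 1 ≤ σ) :
    (p : ℝ) ^ (-σ) ≤ 1 / 2 := by
  have hp : (2 : ℝ) ≤ p := by exact_mod_cast p.2.two_le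
  calc (p : ℝ) ^ (-σ) ≤ (p : ℝ) ^ (-1 : ℝ) :=
        Real.rpow_le_rpow_of_exponent_le (by linarith) (by linarith)
    _ ≤ 1 / 2 := by
        rw [Real.rpow_neg_one, one_div]
        gcongr

theorem Complex.norm_neg_log_one_sub_sub_self_le {z : ℂ} (hz : ‖z‖ ≤ 1 / 2) :
    ‖-Complex.log (1 - z) - z‖ ≤ ‖z‖ ^ 2 := by
  have h := Complex.norm_log_one_add_sub_self_le (z := -z) (by rw [norm_neg]; linarith)
  rw [norm_neg] at h
  have h2 : (1 - ‖z‖)⁻¹ ≤ 2 := inv_le_of_inv_le₀ (by norm_num) (by linarith)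
  calc ‖-Complex.log (1 - z) - z‖ = ‖Complex.log (1 + -z) - -z‖ := by
        rw [← norm_neg]
        congr 1
        ring_nf
    _ ≤ _ := h
    _ ≤ ‖z‖ ^ 2 * 2 / 2 := by gcongr
    _ = _ := by ring

/-- The logarithm `-∑_p log(1 - exp(i x_p) p ^ (-s))` of `ζ_x(s)` given by the Euler product. -/
noncomputable def logZetaTwist (x : ℕ → ℝ) (s : ℂ) : ℂ :=
  ∑' p : Nat.Primes, -Complex.log (1 - zetaTwistSummandHom x s p)

theorem exp_logZetaTwist (x : ℕ → ℝ) {s : ℂ} (hs : 1 < s.re) :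
    Complex.exp (logZetaTwist x s) = zetaTwist x s :=
  EulerProduct.exp_tsum_primes_log_eq_tsum (summable_norm_zetaTwistSummandHom x hs)

theorem norm_neg_log_one_sub_zetaTwistSummandHom_le (x : ℕ → ℝ) {σ : ℝ} (hσ : 1 ≤ σ) (t : ℝ)
    (p : Nat.Primes) :
    ‖-Complex.log (1 - zetaTwistSummandHom x (σ + t * Complex.I) p)‖ ≤ 2 * (p : ℝ) ^ (-σ) := by
  have hn := norm_zetaTwistSummandHom_prime x σ t p
  have hh := p.rpow_neg_le_half hσ
  set z := zetaTwistSummandHom x (σ + t * Complex.I) p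
  have h := Complex.norm_neg_log_one_sub_sub_self_le (hn.trans_le hh)
  have h2 : ‖-Complex.log (1 - z)‖ ≤ ‖-Complex.log (1 - z) - z‖ + ‖z‖ := by
    simpa using norm_add_le (-Complex.log (1 - z) - z) z
  rw [← hn] at hh ⊢
  nlinarith [norm_nonneg z]

theorem continuousOn_logZetaTwist (x : ℕ → ℝ) (t : ℝ) :
    ContinuousOn (fun σ : ℝ => logZetaTwist x (σ + t * Complex.I)) (Set.Ioi 1) := by
  -- The series converges locally uniformly: on `[a, ∞)` it is dominated by `∑_p 2 p ^ (-a)`.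
  have key : ∀ a : ℝ, 1 < a →
      ContinuousOn (fun σ : ℝ => logZetaTwist x (σ + t * Complex.I)) (Set.Ici a) := by
    intro a ha
    refine continuousOn_tsum (u := fun p : Nat.Primes => 2 * (p : ℝ) ^ (-a)) (fun p => ?_)
      ((Nat.Primes.summable_rpow.2 (by linarith)).mul_left 2) fun p σ hσ => ?_
    · have hc : Continuous fun σ : ℝ => zetaTwistSummandHom x (σ + t * Complex.I) p := by
        simp_rw [zetaTwistSummandHom_prime]
        have hp : (0 : ℝ) < p := Nat.cast_pos.2 p.2.pos
        have : Continuous fun σ : ℝ => (p : ℝ) ^ (-σ) :=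
          continuous_const.rpow continuous_neg fun _ => Or.inl hp.ne'
        fun_prop
      refine ((continuous_const.sub hc).continuousOn.clog fun σ hσ => ?_).neg
      rw [sub_eq_add_neg]
      apply Complex.mem_slitPlane_of_norm_lt_one
      rw [Pi.neg_apply, norm_neg, norm_zetaTwistSummandHom_prime]
      linarith [p.rpow_neg_le_half (ha.le.trans hσ)]
    · refine (norm_neg_log_one_sub_zetaTwistSummandHom_le x (ha.le.trans hσ) t p).trans ?_
      gcongr
      · exact_mod_cast p.2.one_le
      · exact hσ
  intro σ hσ
  obtain ⟨a, ha, haσ⟩ := exists_between (Set.mem_Ioi.1 hσ)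
  exact ((key a ha).continuousAt (Ici_mem_nhds haσ)).continuousWithinAt

/-- Up to an error bounded uniformly in `Re s > 1`, the logarithm of `ζ_x` is the prime sum
`∑_p exp(i x_p) p ^ (-s)`. -/
theorem norm_logZetaTwist_sub_tsum_le (x : ℕ → ℝ) {σ : ℝ} (hσ : 1 < σ) (t : ℝ) :
    ‖logZetaTwist x (σ + t * Complex.I) -
      ∑' p : Nat.Primes, zetaTwistSummandHom x (σ + t * Complex.I) p‖ ≤
      ∑' p : Nat.Primes, (p : ℝ) ^ (-2 : ℝ) := by
  have hs : Summable fun p : Nat.Primes => (p : ℝ) ^ (-σ) :=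
    Nat.Primes.summable_rpow.2 (by linarith)
  have h1 : Summable fun p : Nat.Primes =>
      -Complex.log (1 - zetaTwistSummandHom x (σ + t * Complex.I) p) :=
    Summable.of_norm_bounded (hs.mul_left 2)
      (norm_neg_log_one_sub_zetaTwistSummandHom_le x hσ.le t)
  have h2 : Summable fun p : Nat.Primes => zetaTwistSummandHom x (σ + t * Complex.I) p :=
    Summable.of_norm_bounded hs fun p => (norm_zetaTwistSummandHom_prime x σ t p).le
  rw [logZetaTwist, ← h1.tsum_sub h2]
  refine tsum_of_norm_bounded (Nat.Primes.summable_rpow.2 (by norm_num)).hasSum fun p => ?_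
  have hn := norm_zetaTwistSummandHom_prime x σ t p
  refine (Complex.norm_neg_log_one_sub_sub_self_le
    (hn.trans_le (p.rpow_neg_le_half hσ.le))).trans ?_
  rw [hn, ← Real.rpow_mul_natCast (Nat.cast_nonneg _)]
  refine Real.rpow_le_rpow_of_exponent_le (by exact_mod_cast p.2.one_le) ?_
  push_cast
  linarith

theorem norm_logZetaTwist_le (x : ℕ → ℝ) {σ : ℝ} (hσ : 1 < σ) (t : ℝ) :
    ‖logZetaTwist x (σ + t * Complex.I)‖ ≤ 2 * ∑' p : Nat.Primes, (p : ℝ) ^ (-σ) := by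
  have hs : Summable fun p : Nat.Primes => (p : ℝ) ^ (-σ) :=
    Nat.Primes.summable_rpow.2 (by linarith)
  exact tsum_of_norm_bounded (hs.hasSum.mul_left 2)
    (norm_neg_log_one_sub_zetaTwistSummandHom_le x hσ.le t)

/-! ### Vertical shifts with large argument near the line `Re s = 1` -/

/-- The prime sum `∑_p p ^ (-u)` is unbounded as `u` decreases to `1`. -/
theorem exists_lt_tsum_primes_rpow_neg (B : ℝ) {v : ℝ} (hv : 1 < v) :
    ∃ u, 1 < u ∧ u < v ∧ B < ∑' p : Nat.Primes, (p : ℝ) ^ (-u) := by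
  obtain ⟨F, hF⟩ : ∃ F : Finset Nat.Primes, B < ∑ p ∈ F, (p : ℝ) ^ (-1 : ℝ) := by
    by_contra! h
    refine absurd (Nat.Primes.summable_rpow.1 (summable_of_sum_le (fun p => ?_) h)) (lt_irrefl _)
    positivity
  have hc : Continuous fun u : ℝ => ∑ p ∈ F, (p : ℝ) ^ (-u) :=
    continuous_finsetSum _ fun p _ =>
      continuous_const.rpow continuous_neg fun _ => Or.inl (Nat.cast_ne_zero.2 p.2.ne_zero)
  have hev : ∀ᶠ u in nhdsWithin (1 : ℝ) (Set.Ioi 1), B < ∑ p ∈ F, (p : ℝ) ^ (-u) :=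
    (hc.tendsto 1).mono_left nhdsWithin_le_nhds |>.eventually (lt_mem_nhds hF)
  obtain ⟨u, hu, hu1, huv⟩ := (hev.and (Ioo_mem_nhdsGT hv)).exists
  refine ⟨u, hu1, huv, hu.trans_le ?_⟩
  exact (Nat.Primes.summable_rpow.2 (by linarith)).sum_le_tsum _ fun p _ => by positivity

/-- If `S` carries the prime sum at `u` up to `1`, and the summands of `ζ_x(u + it)` at the primes
of `S` point to within `π / 3` of the positive imaginary axis, then the argument at `u + it` is
large. -/
theorem le_im_logZetaTwist (x : ℕ → ℝ) {u : ℝ} (hu : 1 < u) (t : ℝ) (S : Finset Nat.Primes)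
    (hS : ∑' p : Nat.Primes, (p : ℝ) ^ (-u) - 1 ≤ ∑ p ∈ S, (p : ℝ) ^ (-u))
    (ht : ∀ p ∈ S, 1 / 2 ≤ Real.sin (-Real.log p * t + twistPhase x p)) :
    (∑' p : Nat.Primes, (p : ℝ) ^ (-u)) / 2 - 3 / 2 - ∑' p : Nat.Primes, (p : ℝ) ^ (-2 : ℝ) ≤
      (logZetaTwist x (u + t * Complex.I)).im := by
  classical
  have hs : Summable fun p : Nat.Primes => (p : ℝ) ^ (-u) :=
    Nat.Primes.summable_rpow.2 (by linarith)
  have h2 : Summable fun p : Nat.Primes => zetaTwistSummandHom x (u + t * Complex.I) p :=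
    Summable.of_norm_bounded hs fun p => (norm_zetaTwistSummandHom_prime x u t p).le
  -- The sine is at least `1 / 2` on `S` and at least `-1` off `S`.
  have hfin : HasSum (fun p : Nat.Primes => if p ∈ S then 3 / 2 * (p : ℝ) ^ (-u) else 0)
      (∑ p ∈ S, 3 / 2 * (p : ℝ) ^ (-u)) := by
    rw [← Finset.sum_congr rfl fun p hp => if_pos hp]
    exact hasSum_sum_of_ne_finset_zero fun p hp => if_neg hp
  have hle : ∑ p ∈ S, 3 / 2 * (p : ℝ) ^ (-u) - ∑' p : Nat.Primes, (p : ℝ) ^ (-u) ≤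
      (∑' p : Nat.Primes, zetaTwistSummandHom x (u + t * Complex.I) p).im := by
    refine hasSum_le (fun p => ?_) (hfin.sub hs.hasSum) (Complex.hasSum_im h2.hasSum)
    rw [zetaTwistSummandHom_prime, Complex.im_ofReal_mul, Complex.exp_ofReal_mul_I_im]
    have hp : 0 ≤ (p : ℝ) ^ (-u) := by positivity
    split_ifs with hpS
    · nlinarith [ht p hpS]
    · nlinarith [Real.neg_one_le_sin (-Real.log p * t + twistPhase x p)]
  rw [← Finset.mul_sum] at hle
  have h3 := (Complex.abs_im_le_norm _).trans (norm_logZetaTwist_sub_tsum_le x hu t)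
  rw [Complex.sub_im] at h3
  linarith [(abs_le.1 h3).1]

theorem isRelativelyDense_setOf_half_le_sin (φ : ℕ → ℝ) (S : Finset Nat.Primes) :
    IsRelativelyDense {t | ∀ p ∈ S, 1 / 2 ≤ Real.sin (-Real.log p * t + φ p)} := by
  -- `sin θ = cos (θ - π / 2)`
  have h := isRelativelyDense_setOf_le_cos (fun p : S => -Real.log (p : Nat.Primes))
    (injective_sum_natCast_mul_neg_log (p := fun p : S => ((p : Nat.Primes) : ℕ))
      (fun p => (p : Nat.Primes).2) (Nat.Primes.coe_nat_injective.comp Subtype.val_injective))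
    (fun p => φ (p : Nat.Primes) - Real.pi / 2) (δ := 1 / 2) (by norm_num)
  convert h using 3 with t
  simp [← add_sub_assoc, Real.cos_sub_pi_div_two]

/-- A relatively dense set contains the range of a sequence that is still relatively dense. -/
theorem IsRelativelyDense.exists_range_subset {G : Set ℝ} (hG : IsRelativelyDense G) :
    ∃ t : ℕ → ℝ, IsRelativelyDense (Set.range t) ∧ ∀ m, t m ∈ G := by
  obtain ⟨l, hl, h⟩ := hG
  choose f hfG hf using fun k : ℤ => h (k * l)
  refine ⟨fun m => f (Equiv.intEquivNat.symm m), ⟨2 * l, by positivity, fun a => ?_⟩,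
    fun m => hfG _⟩
  -- The interval `[k * l, (k + 1) * l]` with `k = ⌈a / l⌉` is contained in `[a, a + 2 * l]`.
  refine ⟨f ⌈a / l⌉, ⟨Equiv.intEquivNat ⌈a / l⌉, by simp⟩, ?_⟩
  have h1 : a ≤ ⌈a / l⌉ * l := (div_le_iff₀ hl).1 (Int.le_ceil _)
  have h2 : ((⌈a / l⌉ : ℝ) - 1) * l < a :=
    (lt_div_iff₀ hl).1 (by linarith [Int.ceil_lt_add_one (a / l)])
  obtain ⟨h3, h4⟩ := hf ⌈a / l⌉
  exact ⟨h1.trans h3, by linarith⟩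

theorem makesAtLeastTurns_zetaTwist (x : ℕ → ℝ) {u v σ₀ : ℝ} (hu : 1 < u) (huv : u < v)
    (hv : v < σ₀) (t : ℝ) (n : ℕ)
    (h : 2 * Real.pi * n ≤ (logZetaTwist x (u + t * Complex.I)).im -
      (logZetaTwist x (v + t * Complex.I)).im) :
    MakesAtLeastTurns (fun σ : ℝ => zetaTwist x ((σ : ℂ) + (t : ℂ) * Complex.I)) 1 σ₀ n := by
  have hc : ContinuousOn (fun σ : ℝ => logZetaTwist x (σ + t * Complex.I)) (Set.Ioo 1 σ₀) :=
    (continuousOn_logZetaTwist x t).mono Set.Ioo_subset_Ioi_self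
  have hexp : ∀ σ ∈ Set.Ioo 1 σ₀, zetaTwist x ((σ : ℂ) + (t : ℂ) * Complex.I) =
      Complex.exp (logZetaTwist x (σ + t * Complex.I)) := fun σ hσ =>
    (exp_logZetaTwist x (by simpa using hσ.1)).symm
  refine ⟨hc.cexp.congr hexp, fun σ hσ => (hexp σ hσ).trans_ne (Complex.exp_ne_zero _),
    fun σ => (logZetaTwist x (σ + t * Complex.I)).im, Complex.continuous_im.comp_continuousOn hc,
    fun σ hσ => ?_, u, ⟨hu, huv.trans hv⟩, v, ⟨hu.trans huv, hv⟩, ?_⟩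
  · simp only [hexp σ hσ]
    rw [Complex.norm_exp, Complex.ofReal_exp, ← Complex.exp_add, Complex.re_add_im]
  · rw [abs_sub_comm]
    exact h.trans (le_abs_self _)

theorem theorem3 (x : ℕ → ℝ) (σ₀ : ℝ) (hσ₀ : 1 < σ₀) (n : ℕ) :
    ∃ t : ℕ → ℝ, IsRelativelyDense (Set.range t) ∧
      ∀ m : ℕ, MakesAtLeastTurns
        (fun σ : ℝ => zetaTwist x ((σ : ℂ) + (t m : ℂ) * Complex.I)) 1 σ₀ n := by
  obtain ⟨v, hv1, hv⟩ := exists_between hσ₀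
  -- `B` beats the required turning, the error of the prime sum at `u`, and the argument at `v`.
  set B : ℝ := 2 * (2 * Real.pi * n + 3 / 2 + ∑' p : Nat.Primes, (p : ℝ) ^ (-2 : ℝ) +
    2 * ∑' p : Nat.Primes, (p : ℝ) ^ (-v)) with hB
  obtain ⟨u, hu1, huv, hu⟩ := exists_lt_tsum_primes_rpow_neg B hv1
  have hs : Summable fun p : Nat.Primes => (p : ℝ) ^ (-u) :=
    Nat.Primes.summable_rpow.2 (by linarith)
  obtain ⟨S, hS⟩ := (hs.hasSum.eventually (lt_mem_nhds (sub_one_lt _))).exists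
  obtain ⟨t, htd, ht⟩ :=
    (isRelativelyDense_setOf_half_le_sin (twistPhase x) S).exists_range_subset
  refine ⟨t, htd, fun m => makesAtLeastTurns_zetaTwist x hu1 huv hv (t m) n ?_⟩
  have h1 := le_im_logZetaTwist x hu1 (t m) S hS.le (ht m)
  have h2 := (Complex.abs_im_le_norm _).trans (norm_logZetaTwist_le x hv1 (t m))
  linarith [(abs_le.1 h2).2]
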